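/- Let $\mathbb F$ be a field, $n,d\ge 0$ integers and $S\subseteq\mathbb F^n$. The (affine) Hilbert function $\mathrm h_S(d,\mathbb F)$ is the dimension over $\mathbb F$ of the vector space $\{f|_S : f\in\mathbb F[X_1,\dots,X_n],\ \deg f\le d\}\subseteq\mathbb F^S$ of restrictions to $S$ of polynomials of total degree at most $d$. For $n,q,k\in\mathbb N$ with $k\le q^n$, let $\mathrm M^n_q(k)$ be the set of the first $k$ elements of $\{0,\dots,q-1\}^n$ in lexicographic order, where $x$ precedes $y\neq x$ if $x_i<y_i$ for the smallest index $i$ with $x_i\ne y_i$. For $T\subseteq\{0,\dots,q-1\}^n$ let $T_{\le d}=\{x\in T:\sum_{i=1}^n x_i\le d\}$ (the sum is taken in the integers), and let $\binom{m}{\le d}=\sum_{i=0}^d\binom mi$. For every prime power $q$ and all integers $n,k,d\ge 0$ with $k\le q^n$, \[ \min_{S\subseteq\mathbb F_q^n:\ |S|=k}\mathrm h_S(d,\mathbb F_q)=\left|\mathrm M^n_q(k)_{\le d}\right| . \] In particular, for $q=2$, all integers $n,d\ge 0$ and $1\le k\le 2^n$, and every $S\subseteq\mathbb F_2^n$ of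 size $|S|=k$, \[ \mathrm h_S(d,\mathbb F_2)\ \ge\ \binom{\lfloor\log_2 k\rfloor}{\le d}. \] -/

import Mathlib

/-- The space of restrictions to `S` of the `n`-variate polynomials of total degree at most `d`,
as a subspace of the space of all maps from `S` to `F`. -/
noncomputable def restrictionSpace {F : Type*} [Field F] {n : ℕ} (S : Set (Fin n → F)) (d : ℕ) :
    Submodule F (S → F) :=
  (MvPolynomial.restrictTotalDegree (Fin n) F d).map
    (LinearMap.pi fun x : S => (MvPolynomial.aeval (x : Fin n → F)).toLinearMap)

/-- The affine Hilbert function of `S ⊆ F ^ n` at `d`. -/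
noncomputable def hilbertFunction {F : Type*} [Field F] {n : ℕ} (S : Set (Fin n → F)) (d : ℕ) : ℕ :=
  Module.finrank F (restrictionSpace S d)

/-- The first `k` elements of `{0, …, q - 1} ^ n` in the lexicographic order, that is, those with
fewer than `k` strict predecessors. -/
def lexFirst (n q k : ℕ) : Set (Fin n → Fin q) :=
  {x | {y : Fin n → Fin q | toLex y < toLex x}.ncard < k}

/-- The elements of `T` of generalized Hamming weight at most `d`. -/
def lowWeight {n q : ℕ} (T : Set (Fin n → Fin q)) (d : ℕ) : Set (Fin n → Fin q) :=
  {x ∈ T | ∑ i, (x i : ℕ) ≤ d}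

/-- The sum of the binomial coefficients `m` choose `i` over `0 ≤ i ≤ d`. -/
def chooseLE (m d : ℕ) : ℕ :=
  ∑ i ∈ Finset.range (d + 1), m.choose i

/-! Reading a point as the number whose base `q` digits are its coordinates turns the lexicographic
order into the order of `ℕ` and the weight into the digit sum, so the claimed minimum is `lowCount q
(d + 1) k`. The strict bound `D = d + 1` makes truncated subtraction harmless: `D - j = 0` means an
empty count.

Lower bound, by induction on `n`: multiplying by `X 0 - a` kills the slice at `a` and costs one
degree, so the Hilbert functions of the slices, with bounds `D, D - 1, …` in any order, add up to at
most that of `S` (`sum_hilbertFunctionLT_headSlice_le`). With the largest slices first, what remains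
is the numerical inequality `lowCount_sum_le`. There, numbers are split by last digit; induction
handles each digit and leaves columns whose heights differ by at most `q`
(`lowCount_le_sum_columns`). These reduce to Young diagrams in a square box (`boxCount_le_sum_rows`)
and to joining two segments (`lowCount_add_le`).

Upper bound: the initial segment is a down-set, and by the combinatorial Nullstellensatz a
polynomial of degree at most `d` that vanishes at its points of weight at most `d` vanishes on all
of it (`eval_eq_zero_of_box`). -/

/-- The sum of the base `q` digits of `m`. -/
def digitSum (q m : ℕ) : ℕ :=
  (Nat.digits q m).sum

/-- The number of `m < k` whose base `q` digit sum is less than `D`. -/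
def lowCount (q D k : ℕ) : ℕ :=
  ((Finset.range k).filter fun m => digitSum q m < D).card

/-! ### Digit sums -/

theorem digitSum_zero (q : ℕ) : digitSum q 0 = 0 := by
  simp [digitSum]

theorem digitSum_mul_add {q : ℕ} (hq : 1 < q) (t : ℕ) {c : ℕ} (hc : c < q) :
    digitSum q (q * t + c) = digitSum q t + c := by
  by_cases h : c = 0 ∧ t = 0
  · rcases h with ⟨rfl, rfl⟩
    simp [digitSum]
  · rw [digitSum, add_comm, Nat.digits_add q hq c t hc (by omega), List.sum_cons, digitSum,
      add_comm]

theorem digitSum_of_lt {q : ℕ} (hq : 1 < q) {c : ℕ} (hc : c < q) : digitSum q c = c := by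
  simpa [digitSum_zero] using digitSum_mul_add hq 0 hc

/-- A carry resets the last digit from `q - 1` to `0` and passes the increment on to the quotient.
-/
theorem digitSum_succ_le {q : ℕ} (hq : 1 < q) (m : ℕ) : digitSum q (m + 1) ≤ digitSum q m + 1 := by
  induction m using Nat.strong_induction_on with
  | _ m ih =>
    have hm := Nat.div_add_mod m q
    have hlt := Nat.mod_lt m (by omega : 0 < q)
    have h1 := digitSum_mul_add hq (m / q) hlt
    rw [hm] at h1
    by_cases h : m % q + 1 < q
    · have h2 := digitSum_mul_add hq (m / q) h
      rw [← add_assoc, hm] at h2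
      omega
    · have h2 := digitSum_mul_add hq (m / q + 1) (by omega : 0 < q)
      have h3 : q * (m / q + 1) + 0 = m + 1 := by
        rw [mul_add]; omega
      rw [h3] at h2
      have h4 : m / q < m := Nat.div_lt_self (by omega) hq
      have := ih _ h4
      omega

theorem digitSum_mul_pow_add {q : ℕ} (hq : 1 < q) (n U : ℕ) {y : ℕ} (hy : y < q ^ n) :
    digitSum q (q ^ n * U + y) = digitSum q U + digitSum q y := by
  induction n generalizing y with
  | zero =>
    obtain rfl : y = 0 := by simpa using hy
    simp [digitSum_zero]
  | succ n ih =>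
    have hm := Nat.div_add_mod y q
    have hlt := Nat.mod_lt y (by omega : 0 < q)
    have h1 := digitSum_mul_add hq (y / q) hlt
    have h2 := digitSum_mul_add hq (q ^ n * U + y / q) hlt
    have h3 : q * (q ^ n * U + y / q) + y % q = q ^ (n + 1) * U + y := by
      rw [mul_add, add_assoc, hm]; ring
    have h4 : y / q < q ^ n := Nat.div_lt_of_lt_mul (by rwa [pow_succ, mul_comm] at hy)
    rw [h3] at h2
    rw [hm] at h1
    have := ih h4
    omega

/-! ### Counting numbers of small digit sum: rows, columns, blocks -/

theorem lowCount_zero_right (q D : ℕ) : lowCount q D 0 = 0 := by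
  simp [lowCount]

theorem lowCount_zero_left (q k : ℕ) : lowCount q 0 k = 0 := by
  simp [lowCount]

theorem lowCount_succ (q D k : ℕ) :
    lowCount q D (k + 1) = lowCount q D k + if digitSum q k < D then 1 else 0 := by
  unfold lowCount
  rw [Finset.range_add_one, Finset.filter_insert]
  split_ifs
  · rw [Finset.card_insert_of_notMem (by simp)]
  · simp

theorem lowCount_mono_right (q D : ℕ) : Monotone (lowCount q D) :=
  monotone_nat_of_le_succ fun k => by rw [lowCount_succ]; omega

theorem lowCount_one {q D : ℕ} : lowCount q D 1 = min 1 D := by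
  rw [lowCount_succ, lowCount_zero_right, digitSum_zero]
  split_ifs <;> omega

/-- The increments of `lowCount` in `k` grow with `D`. -/
theorem lowCount_supermodular (q : ℕ) {D E : ℕ} (h : D ≤ E) {a b : ℕ} (hab : a ≤ b) :
    lowCount q E a + lowCount q D b ≤ lowCount q D a + lowCount q E b := by
  induction b, hab using Nat.le_induction with
  | base => omega
  | succ b _ ih =>
    simp only [lowCount_succ]
    split_ifs <;> omega

theorem lowCount_mul_add {q : ℕ} (hq : 1 < q) (D t : ℕ) {r : ℕ} (hr : r ≤ q) :
    lowCount q D (q * t + r) = lowCount q D (q * t) + min r (D - digitSum q t) := by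
  induction r with
  | zero => simp
  | succ r ih =>
    rw [← add_assoc, lowCount_succ, ih (by omega), digitSum_mul_add hq t (by omega)]
    split_ifs <;> omega

theorem sum_range_boole_lt (n x : ℕ) :
    ∑ c ∈ Finset.range n, (if c < x then 1 else 0) = min n x := by
  induction n with
  | zero => simp
  | succ n ih =>
    rw [Finset.sum_range_succ, ih]
    split_ifs <;> omega

theorem lowCount_mul {q : ℕ} (hq : 1 < q) (D t : ℕ) :
    lowCount q D (q * t) = ∑ c ∈ Finset.range q, lowCount q (D - c) t := by
  induction t with
  | zero => simp [lowCount_zero_right]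
  | succ t ih =>
    have h : ∀ c, (if digitSum q t < D - c then 1 else 0) =
        if c < D - digitSum q t then 1 else 0 := by
      intro c; split_ifs <;> omega
    rw [mul_add, mul_one, lowCount_mul_add hq D t le_rfl, ih]
    simp only [lowCount_succ, Finset.sum_add_distrib, h]
    rw [sum_range_boole_lt]

/-- The numbers below `q * t + r` with last digit `c` have as quotients the numbers below `t`, and
also `t` itself if `c < r`; the last digit uses up `c` of the bound. -/
theorem lowCount_columns {q : ℕ} (hq : 1 < q) (D t : ℕ) {r : ℕ} (hr : r ≤ q) :
    lowCount q D (q * t + r) =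
      ∑ c ∈ Finset.range q, lowCount q (D - c) (t + if c < r then 1 else 0) := by
  have h : ∀ c, lowCount q (D - c) (t + if c < r then 1 else 0) =
      lowCount q (D - c) t + if c < min r (D - digitSum q t) then 1 else 0 := by
    intro c
    by_cases hc : c < r
    · rw [if_pos hc, lowCount_succ]
      congr 1
      split_ifs <;> omega
    · rw [if_neg hc, if_neg (by omega), add_zero, add_zero]
  rw [lowCount_mul_add hq D t hr, lowCount_mul hq]
  simp only [h, Finset.sum_add_distrib]
  rw [sum_range_boole_lt]
  omega

/-- All numbers of the block share the leading digits `U`, which use up `digitSum q U` of the bound.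
-/
theorem lowCount_mul_pow_add {q : ℕ} (hq : 1 < q) (n D U : ℕ) {x : ℕ} (hx : x ≤ q ^ n) :
    lowCount q D (q ^ n * U + x) =
      lowCount q D (q ^ n * U) + lowCount q (D - digitSum q U) x := by
  induction x with
  | zero => simp [lowCount_zero_right]
  | succ x ih =>
    rw [← add_assoc, lowCount_succ, ih (by omega), digitSum_mul_pow_add hq n U (by omega),
      lowCount_succ]
    split_ifs <;> omega

/-! ### Joining two segments -/

/-- Joining two initial segments of which the second, not longer one, is raised by one. -/
theorem lowCount_add_le {q : ℕ} (hq : 1 < q) (E : ℕ) {A B : ℕ} (h : B ≤ A) :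
    lowCount q E (A + B) ≤ lowCount q E A + lowCount q (E - 1) B := by
  induction hk : A + B using Nat.strong_induction_on generalizing A B E with
  | _ k ih =>
    subst hk
    rcases Nat.eq_zero_or_pos B with rfl | hB
    · simp
    -- For `A = B = 1` the column of last digit `0` again has total `2`, so the induction would not
    -- descend.
    by_cases hA : A = 1
    · obtain rfl : B = 1 := by omega
      subst hA
      rw [lowCount_succ, lowCount_one, lowCount_one, digitSum_of_lt hq hq]
      split_ifs <;> omega
    obtain ⟨α, r, hr, rfl⟩ : ∃ α r, r < q ∧ A = q * α + r :=
      ⟨A / q, A % q, Nat.mod_lt _ (by omega), (Nat.div_add_mod A q).symm⟩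
    obtain ⟨β, t, ht, rfl⟩ : ∃ β t, t < q ∧ B = q * β + t :=
      ⟨B / q, B % q, Nat.mod_lt _ (by omega), (Nat.div_add_mod B q).symm⟩
    have hαβ : β ≤ α := by
      by_contra hlt
      have : q * (α + 1) ≤ q * β := Nat.mul_le_mul_left _ (by omega)
      rw [mul_add] at this
      omega
    have hcol : ∀ c, β + (if c < t then 1 else 0) ≤ α + if c < r then 1 else 0 := by
      intro c
      rcases hαβ.lt_or_eq with h1 | h1
      · split_ifs <;> omega
      · subst h1
        split_ifs <;> omega
    have hα : 2 * α ≤ q * α := Nat.mul_le_mul_right _ hq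
    have hβ : 2 * β ≤ q * β := Nat.mul_le_mul_right _ hq
    rw [lowCount_columns hq E α hr.le, lowCount_columns hq (E - 1) β ht.le,
      ← Finset.sum_add_distrib]
    have key : ∑ c ∈ Finset.range q, lowCount q (E - c)
        ((α + if c < r then 1 else 0) + (β + if c < t then 1 else 0)) ≤
        ∑ c ∈ Finset.range q, (lowCount q (E - c) (α + if c < r then 1 else 0) +
          lowCount q (E - 1 - c) (β + if c < t then 1 else 0)) := by
      refine Finset.sum_le_sum fun c _ => ?_
      have := ih _ ?_ (E - c) (hcol c) rfl
      · rwa [Nat.sub_right_comm]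
      · split_ifs <;> omega
    refine le_trans ?_ key
    -- Stacking the columns puts `max r t` cells in row `α + β` and `min r t` in the next. The
    -- joined segment moves cells of the upper row to the free end of the lower one; as `digitSum q
    -- (α + β + 1) ≤ digitSum q (α + β) + 1`, this can be done without lowering any digit sum.
    have hmm : ∀ c, lowCount q (E - c)
        ((α + if c < r then 1 else 0) + (β + if c < t then 1 else 0)) =
        lowCount q (E - c) (α + β) +
          (if c < min (max r t) (E - digitSum q (α + β)) then 1 else 0) +
          if c < min (min r t) (E - digitSum q (α + β + 1)) then 1 else 0 := by
      intro c
      have h2 : ((α + if c < r then 1 else 0) + (β + if c < t then 1 else 0)) =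
          α + β + (if c < max r t then 1 else 0) + (if c < min r t then 1 else 0) := by
        split_ifs <;> omega
      rw [h2]
      by_cases h3 : c < min r t
      · have h4 : c < max r t := by omega
        rw [if_pos h3, if_pos h4, lowCount_succ, lowCount_succ]
        congr 1
        · congr 1
          split_ifs <;> omega
        · split_ifs <;> omega
      · rw [if_neg h3, if_neg (by omega : ¬ c < min (min r t) _), add_zero, add_zero]
        by_cases h4 : c < max r t
        · rw [if_pos h4, lowCount_succ]
          congr 1
          split_ifs <;> omega
        · rw [if_neg h4, if_neg (by omega), add_zero, add_zero]
    simp only [hmm, Finset.sum_add_distrib]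
    rw [sum_range_boole_lt, sum_range_boole_lt, ← lowCount_mul hq]
    have hs := digitSum_succ_le hq (α + β)
    have hsum : q * α + r + (q * β + t) = q * (α + β) + (r + t) := by ring
    rw [hsum]
    by_cases hrt : r + t ≤ q
    · rw [lowCount_mul_add hq _ _ hrt]
      omega
    · have hsum' : q * (α + β) + (r + t) = q * (α + β + 1) + (r + t - q) := by
        rw [mul_add q (α + β)]; omega
      rw [hsum', lowCount_mul_add hq _ _ (by omega), mul_add q (α + β), mul_one,
        lowCount_mul_add hq _ _ le_rfl]
      omega

/-! ### Young diagrams in a square box -/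

/-- The number of the first `k` cells of an array with rows of length `L`, filled row by row, whose
row and column indices add up to less than `D`. -/
def boxCount (L D k : ℕ) : ℕ :=
  ((Finset.range k).filter fun x => x / L + x % L < D).card

theorem boxCount_succ (L D k : ℕ) :
    boxCount L D (k + 1) = boxCount L D k + if k / L + k % L < D then 1 else 0 := by
  unfold boxCount
  rw [Finset.range_add_one, Finset.filter_insert]
  split_ifs
  · rw [Finset.card_insert_of_notMem (by simp)]
  · simp

theorem boxCount_of_le {L k : ℕ} (D : ℕ) (hk : k ≤ L) : boxCount L D k = min k D := by
  induction k with
  | zero => simp [boxCount]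
  | succ k ih =>
    rw [boxCount_succ, ih (by omega), Nat.div_eq_of_lt (by omega), Nat.mod_eq_of_lt (by omega)]
    split_ifs <;> omega

theorem boxCount_add {L : ℕ} (hL : 0 < L) (D k : ℕ) :
    boxCount L D (L + k) = min L D + boxCount L (D - 1) k := by
  induction k with
  | zero => rw [add_zero, boxCount_of_le D le_rfl]; simp [boxCount]
  | succ k ih =>
    rw [← add_assoc, boxCount_succ, ih, boxCount_succ, Nat.add_div_left _ hL, Nat.add_mod_left]
    generalize k / L = a
    split_ifs <;> omega

theorem boxCount_rows {L r : ℕ} (hL : 0 < L) (hr : r ≤ L) (c D : ℕ) :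
    boxCount L D (L * c + r) = ∑ j ∈ Finset.range c, min L (D - j) + min r (D - c) := by
  induction c generalizing D with
  | zero => simp [boxCount_of_le D hr]
  | succ c ih =>
    rw [show L * (c + 1) + r = L + (L * c + r) by ring, boxCount_add hL, ih,
      Finset.sum_range_succ']
    have : ∑ j ∈ Finset.range c, min L (D - (j + 1)) =
        ∑ j ∈ Finset.range c, min L (D - 1 - j) :=
      Finset.sum_congr rfl fun j _ => by omega
    rw [this, Nat.sub_zero]
    omega

/-- Numbers below `q ^ 2` have at most two digits. The box count is detached from the base because
the induction on diagrams changes the side of the box. -/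
theorem lowCount_eq_boxCount {q : ℕ} (hq : 1 < q) (D : ℕ) {k : ℕ} (hk : k ≤ q ^ 2) :
    lowCount q D k = boxCount q D k := by
  induction k with
  | zero => simp [lowCount, boxCount]
  | succ k ih =>
    have h1 := digitSum_mul_add hq (k / q) (Nat.mod_lt k (by omega : 0 < q))
    have h2 : k / q < q := Nat.div_lt_of_lt_mul (by rw [← sq]; omega)
    rw [Nat.div_add_mod, digitSum_of_lt hq h2] at h1
    rw [lowCount_succ, boxCount_succ, ih (by omega), h1]

theorem sum_range_ite_lt {c n : ℕ} (h : c ≤ n) (g : ℕ → ℕ) :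
    ∑ j ∈ Finset.range n, (if j < c then g j else 0) = ∑ j ∈ Finset.range c, g j := by
  rw [← Finset.sum_filter]
  congr 1
  ext j
  simp only [Finset.mem_filter, Finset.mem_range]
  omega

/-- In a square box, the cells of a Young diagram lie at least as low as those of the diagram of
the same size that is filled row by row. -/
theorem boxCount_le_sum_rows (L D : ℕ) (K : ℕ → ℕ) (hK : Antitone K) (h0 : K 0 ≤ L)
    (hL : K L = 0) :
    boxCount L D (∑ j ∈ Finset.range L, K j) ≤ ∑ j ∈ Finset.range L, min (K j) (D - j) := by
  induction L generalizing D K with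
  | zero => simp [boxCount]
  | succ N ihN =>
  induction hk : ∑ j ∈ Finset.range (N + 1), K j using Nat.strong_induction_on
    generalizing D K with
  | _ k ihk =>
    -- A full first row is shared with the row-by-row filling; removing it from both lowers `D` by
    -- one. `K` is arbitrary here since a modified diagram is stripped below.
    have strip : ∀ K : ℕ → ℕ, Antitone K → K 0 = N + 1 → K (N + 1) = 0 →
        ∑ j ∈ Finset.range (N + 1), K j = k →
        boxCount (N + 1) D k ≤ ∑ j ∈ Finset.range (N + 1), min (K j) (D - j) := by
      intro K hK h0 hL hk
      have h1 : ∑ j ∈ Finset.range (N + 1), K j =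
          K 0 + ∑ j ∈ Finset.range (N + 1), K (j + 1) := by
        rw [add_comm (K 0), ← Finset.sum_range_succ' K, Finset.sum_range_succ K (N + 1), hL,
          add_zero]
      have h2 : ∑ j ∈ Finset.range (N + 1), min (K j) (D - j) =
          min (K 0) D + ∑ j ∈ Finset.range (N + 1), min (K (j + 1)) (D - 1 - j) := by
        have h3 := Finset.sum_range_succ' (fun j => min (K j) (D - j)) (N + 1)
        rw [Finset.sum_range_succ, hL, Nat.zero_min, add_zero] at h3
        rw [h3, add_comm, Nat.sub_zero]
        exact congrArg _ (Finset.sum_congr rfl fun j _ => by omega)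
      have h4 := ihk (k - (N + 1)) (by omega) (D - 1) (fun j => K (j + 1))
        (fun a b hab => hK (by omega)) (h0 ▸ hK (by omega))
        (Nat.le_zero.1 (hL ▸ hK (by omega))) (by omega)
      rw [h2, h0]
      have h5 := boxCount_add (L := N + 1) (by omega) D (k - (N + 1))
      rw [show N + 1 + (k - (N + 1)) = k by omega] at h5
      omega
    rcases h0.eq_or_lt with h0 | h0
    · exact strip K hK h0 hL hk
    rcases Nat.eq_zero_or_pos (K N) with hN | hN
    swap
    -- The first column is full. It has the same weights as a full first row, so it can be removed
    -- against one.
    · have hpos : ∀ j ∈ Finset.range (N + 1), 1 ≤ K j := fun j hj =>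
        le_trans hN (hK (by simpa [Nat.lt_succ_iff] using hj))
      have h1 : ∑ j ∈ Finset.range (N + 1), K j =
          N + 1 + ∑ j ∈ Finset.range (N + 1), (K j - 1) := by
        rw [← Finset.sum_congr rfl fun j hj => Nat.sub_add_cancel (hpos j hj),
          Finset.sum_add_distrib]
        simp [add_comm]
      have h2 : ∑ j ∈ Finset.range (N + 1), min (K j) (D - j) =
          min (N + 1) D + ∑ j ∈ Finset.range (N + 1), min (K j - 1) (D - 1 - j) := by
        rw [← sum_range_boole_lt, ← Finset.sum_add_distrib]
        refine Finset.sum_congr rfl fun j hj => ?_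
        have := hpos j hj
        split_ifs <;> omega
      have h4 := ihk (k - (N + 1)) (by omega) (D - 1) (fun j => K j - 1)
        (fun a b hab => Nat.sub_le_sub_right (hK hab) 1) (by omega) (by simp [hL]) (by omega)
      have h5 := boxCount_add (L := N + 1) (by omega) D (k - (N + 1))
      rw [show N + 1 + (k - (N + 1)) = k by omega] at h5
      omega
    -- The diagram fits in the box of side `N`; it remains to compare the fillings of widths `N` and
    -- `N + 1`.
    · have h1 := ihN D K hK (by omega) hN
      have hkN : ∑ j ∈ Finset.range N, K j = k := by
        rw [← hk, Finset.sum_range_succ, hN, add_zero]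
      have h2 : k ≤ N * N := by
        rw [← hkN]
        refine (Finset.sum_le_card_nsmul _ _ N fun j _ => ?_).trans (by simp)
        have := hK (Nat.zero_le j)
        omega
      rw [hkN] at h1
      rw [Finset.sum_range_succ, hN, Nat.zero_min, add_zero]
      refine le_trans ?_ h1
      rcases Nat.eq_zero_or_pos k with rfl | hkpos
      · simp [boxCount]
      have hNpos : 0 < N := by
        rcases Nat.eq_zero_or_pos N with rfl | h
        · omega
        · exact h
      -- The remainder is taken in `1, …, N`, so that the last row is nonempty.
      obtain ⟨c, r, hr1, hrN, hcr⟩ : ∃ c r, 1 ≤ r ∧ r ≤ N ∧ k = N * c + r := by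
        refine ⟨(k - 1) / N, (k - 1) % N + 1, by omega, Nat.mod_lt _ hNpos, ?_⟩
        have := Nat.div_add_mod (k - 1) N
        omega
      have hcN : c < N := by
        by_contra hlt
        have : N * N ≤ N * c := Nat.mul_le_mul_left _ (by omega)
        omega
      rcases Nat.eq_zero_or_pos c with rfl | hc
      · rw [boxCount_of_le D (by omega), boxCount_of_le D (by omega)]
      -- In the filling of width `N`, move the last `min c r` cells of row `c` to the ends of the
      -- first `min c r` rows. The `i`-th one goes from weight `max c r + i` to `N + i`, so no
      -- weight drops, and the first row becomes full.
      have h3 := strip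
        (fun j => if j < min c r then N + 1 else if j < c then N else
          if j = c then r - min c r else 0)
        (fun a b hab => by dsimp only; split_ifs <;> omega) (if_pos (by omega))
        (by split_ifs <;> omega) (by
          have : ∀ j, (if j < min c r then N + 1 else if j < c then N else
              if j = c then r - min c r else 0) = (if j < c then N else 0) +
              (if j < min c r then 1 else 0) + (if j = c then r - min c r else 0) := by
            intro j; split_ifs <;> omega
          simp only [this, Finset.sum_add_distrib]
          rw [sum_range_ite_lt (by omega), sum_range_ite_lt (by omega), Finset.sum_ite_eq',
            if_pos (by simp; omega)]
          simp only [Finset.sum_const, Finset.card_range, smul_eq_mul, mul_one]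
          rw [mul_comm] at hcr
          omega)
      refine h3.trans ?_
      have h4 : ∀ j, min (if j < min c r then N + 1 else if j < c then N else
          if j = c then r - min c r else 0) (D - j) = (if j < c then min N (D - j) else 0) +
          (if j < min (min c r) (D - N) then 1 else 0) +
          (if j = c then min (r - min c r) (D - c) else 0) := by
        intro j; split_ifs <;> omega
      simp only [h4, Finset.sum_add_distrib]
      rw [sum_range_ite_lt (by omega), sum_range_boole_lt, Finset.sum_ite_eq',
        if_pos (by simp; omega), hcr, boxCount_rows hNpos hrN]
      omega

theorem lowCount_le_sum_rows {q : ℕ} (hq : 1 < q) (D : ℕ) (K : ℕ → ℕ) (hK : Antitone K)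
    (h0 : K 0 ≤ q) (hL : K q = 0) :
    lowCount q D (∑ j ∈ Finset.range q, K j) ≤ ∑ j ∈ Finset.range q, min (K j) (D - j) := by
  rw [lowCount_eq_boxCount hq]
  · exact boxCount_le_sum_rows q D K hK h0 hL
  · rw [sq]
    refine (Finset.sum_le_card_nsmul _ _ q fun j _ => ?_).trans (by simp)
    exact (hK (Nat.zero_le j)).trans h0

theorem lowCount_mul_add_rows {q : ℕ} (hq : 1 < q) (D t ρ : ℕ) :
    lowCount q D (q * (t + ρ)) =
      lowCount q D (q * t) + ∑ e ∈ Finset.range ρ, min q (D - digitSum q (t + e)) := by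
  induction ρ with
  | zero => simp
  | succ ρ ih =>
    rw [Finset.sum_range_succ, ← add_assoc t, mul_add q (t + ρ), mul_one,
      lowCount_mul_add hq _ _ le_rfl, ih]
    omega

/-! ### Columns of nearly equal heights -/

/-- Initial segments with rows of decreasing lengths on top of full rows. -/
theorem lowCount_add_rows_le {q : ℕ} (hq : 1 < q) (D T : ℕ) (μ : ℕ → ℕ) (hμ : Antitone μ)
    (h0 : μ 0 ≤ q) (hμq : μ q = 0) :
    lowCount q D (q * T + ∑ i ∈ Finset.range q, μ i) ≤
      lowCount q D (q * T) + ∑ i ∈ Finset.range q, min (μ i) (D - digitSum q (T + i)) := by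
  obtain ⟨U, ρ, hρ, rfl⟩ : ∃ U ρ, ρ < q ∧ T = q * U + ρ :=
    ⟨T / q, T % q, Nat.mod_lt _ (by omega), (Nat.div_add_mod T q).symm⟩
  obtain ⟨σ, rfl⟩ : ∃ σ, q = ρ + σ := ⟨q - ρ, by omega⟩
  set q := ρ + σ with hqdef
  have hle : ∀ i, μ i ≤ q := fun i => (hμ (Nat.zero_le i)).trans h0
  -- The rows from `T` on meet at most two blocks of `q` rows: the first `σ` complete block `U`,
  -- whose lower `ρ` rows are full, and the others open block `U + 1`. Thus `A` and `B` are sizes of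
  -- Young diagrams in these blocks.
  set A := q * ρ + ∑ i ∈ Finset.range σ, μ i with hA
  set B := ∑ i ∈ Finset.range ρ, μ (σ + i) with hB
  have hsplit : ∀ g : ℕ → ℕ, ∑ i ∈ Finset.range q, g i =
      ∑ i ∈ Finset.range σ, g i + ∑ i ∈ Finset.range ρ, g (σ + i) := by
    intro g
    rw [hqdef, add_comm ρ, Finset.sum_range_add]
  have hsplit' : ∀ g : ℕ → ℕ, ∑ i ∈ Finset.range q, g i =
      ∑ i ∈ Finset.range ρ, g i + ∑ i ∈ Finset.range σ, g (ρ + i) := by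
    intro g
    rw [hqdef, Finset.sum_range_add]
  have hBA : B ≤ A := by
    have : B ≤ q * ρ := by
      refine (Finset.sum_le_card_nsmul _ _ q fun j _ => hle _).trans (by simp [mul_comm])
    omega
  have hAq : A ≤ q ^ 2 := by
    have : ∑ i ∈ Finset.range σ, μ i ≤ q * σ :=
      (Finset.sum_le_card_nsmul _ _ q fun j _ => hle _).trans (by simp [mul_comm])
    have h2 : q ^ 2 = q * ρ + q * σ := by rw [← mul_add, sq]
    omega
  have hlow : ∀ V e, e < q → digitSum q (q * V + e) = digitSum q V + e :=
    fun V e he => digitSum_mul_add hq V he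
  have hrowsA : lowCount q (D - digitSum q U) A ≤
      ∑ e ∈ Finset.range ρ, min q (D - digitSum q (q * U + e)) +
        ∑ i ∈ Finset.range σ, min (μ i) (D - digitSum q (q * U + ρ + i)) := by
    have h := lowCount_le_sum_rows hq (D - digitSum q U)
      (fun e => if e < ρ then q else if e < q then μ (e - ρ) else 0) (fun a b hab => by
        dsimp only
        have := hle (b - ρ)
        have := hμ (Nat.sub_le_sub_right hab ρ)
        split_ifs <;> omega)
      (by have := hle (0 - ρ); split_ifs <;> omega)
      (by rw [if_neg (by omega), if_neg (by omega)])
    rw [hsplit', hsplit'] at h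
    have e1 : ∑ i ∈ Finset.range ρ, (if i < ρ then q else if i < q then μ (i - ρ) else 0) =
        q * ρ := by
      rw [Finset.sum_congr rfl fun i hi => if_pos (Finset.mem_range.1 hi)]
      simp [mul_comm]
    have e2 : ∑ i ∈ Finset.range σ,
        (if ρ + i < ρ then q else if ρ + i < q then μ (ρ + i - ρ) else 0) =
        ∑ i ∈ Finset.range σ, μ i := by
      refine Finset.sum_congr rfl fun i hi => ?_
      have := Finset.mem_range.1 hi
      rw [if_neg (by omega), if_pos (by omega), Nat.add_sub_cancel_left]
    rw [e1, e2] at h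
    refine h.trans (add_le_add (Finset.sum_le_sum fun i hi => ?_)
      (Finset.sum_le_sum fun i hi => ?_))
    · have := Finset.mem_range.1 hi
      rw [if_pos this, hlow U i (by omega)]
      omega
    · have := Finset.mem_range.1 hi
      rw [if_neg (by omega), if_pos (by omega), Nat.add_sub_cancel_left, add_assoc,
        hlow U (ρ + i) (by omega)]
      omega
  have hrowsB : lowCount q (D - digitSum q (U + 1)) B ≤
      ∑ i ∈ Finset.range ρ, min (μ (σ + i)) (D - digitSum q (q * U + ρ + (σ + i))) := by
    have h := lowCount_le_sum_rows hq (D - digitSum q (U + 1))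
      (fun e => if e < ρ then μ (σ + e) else 0) (fun a b hab => by
        dsimp only
        have := hμ (Nat.add_le_add_left hab σ)
        split_ifs <;> omega)
      (by have := hle (σ + 0); split_ifs <;> omega)
      (by rw [if_neg (by omega)])
    rw [sum_range_ite_lt (by omega) fun e => μ (σ + e), hsplit'] at h
    have e2 : ∑ i ∈ Finset.range σ, min (if ρ + i < ρ then μ (σ + (ρ + i)) else 0)
        (D - digitSum q (U + 1) - (ρ + i)) = 0 := by
      refine Finset.sum_eq_zero fun i _ => ?_
      rw [if_neg (by omega), Nat.zero_min]
    rw [e2, add_zero] at h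
    refine h.trans (Finset.sum_le_sum fun i hi => ?_)
    have := Finset.mem_range.1 hi
    have e3 : q * U + ρ + (σ + i) = q * (U + 1) + i := by
      rw [mul_add, mul_one, hqdef]; ring
    rw [if_pos this, e3, hlow (U + 1) i (by omega)]
    omega
  have hD := lowCount_add_le hq (D - digitSum q U) hBA
  have hs := digitSum_succ_le hq U
  have hBq : B ≤ q ^ 2 := hBA.trans hAq
  have hsum : q * (q * U + ρ) + ∑ i ∈ Finset.range q, μ i = q ^ 2 * U + (A + B) := by
    rw [hsplit, hA, hB]; ring
  rw [hsum, hsplit, lowCount_mul_add_rows hq, show q * (q * U) = q ^ 2 * U by ring]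
  -- Joining gives this with bound `D - digitSum q U - 1` on `B`. The actual bound in block `U + 1`
  -- is at least that, and by supermodularity an overflow `C ≤ B` into that block gains no more from
  -- the difference than `B` does.
  have hAB : lowCount q D (q ^ 2 * U + (A + B)) ≤ lowCount q D (q ^ 2 * U) +
      lowCount q (D - digitSum q U) A + lowCount q (D - digitSum q (U + 1)) B := by
    rcases le_total (A + B) (q ^ 2) with h | h
    · rw [lowCount_mul_pow_add hq 2 D U h]
      have := lowCount_supermodular q
        (show D - digitSum q U - 1 ≤ D - digitSum q (U + 1) by omega) (Nat.zero_le B)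
      simp only [lowCount_zero_right] at this
      omega
    · obtain ⟨C, hC⟩ := Nat.exists_eq_add_of_le h
      have h1 := lowCount_mul_pow_add hq 2 D (U + 1) (show C ≤ q ^ 2 by omega)
      have h2 := lowCount_mul_pow_add hq 2 (D - digitSum q U) 1 (show C ≤ q ^ 2 by omega)
      rw [digitSum_of_lt hq hq, mul_one, ← hC] at h2
      have h3 := lowCount_mul_pow_add hq 2 D U (le_refl (q ^ 2))
      rw [show q ^ 2 * (U + 1) = q ^ 2 * U + q ^ 2 by ring, add_assoc, ← hC] at h1
      have := lowCount_supermodular q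
        (show D - digitSum q U - 1 ≤ D - digitSum q (U + 1) by omega) (show C ≤ B by omega)
      omega
  omega

theorem sum_lt_card_filter {q n : ℕ} (r : ℕ → ℕ) (hr : ∀ j, j ∈ Finset.range n → r j ≤ q) :
    ∑ c ∈ Finset.range q, ((Finset.range n).filter fun j => c < r j).card =
      ∑ j ∈ Finset.range n, r j := by
  simp only [Finset.card_filter]
  rw [Finset.sum_comm]
  refine Finset.sum_congr rfl fun j hj => ?_
  rw [sum_range_boole_lt]
  have := hr j hj
  omega

theorem lowCount_add (q D t l : ℕ) :
    lowCount q D (t + l) =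
      lowCount q D t + ∑ i ∈ Finset.range l, if digitSum q (t + i) < D then 1 else 0 := by
  induction l with
  | zero => simp
  | succ l ih => rw [← add_assoc, lowCount_succ, ih, Finset.sum_range_succ, add_assoc]

/-- The columns of nearly equal heights `T + l c`. -/
theorem lowCount_le_sum_columns {q : ℕ} (hq : 1 < q) (D T : ℕ) (l : ℕ → ℕ) (hl : Antitone l)
    (h0 : l 0 ≤ q) :
    lowCount q D (q * T + ∑ c ∈ Finset.range q, l c) ≤
      ∑ c ∈ Finset.range q, lowCount q (D - c) (T + l c) := by
  have hle : ∀ i, l i ≤ q := fun i => (hl (Nat.zero_le i)).trans h0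
  -- The conjugate partition of `l`: the columns above height `T`, read as rows.
  set μ : ℕ → ℕ := fun i => ((Finset.range q).filter fun c => i < l c).card with hμdef
  have hμ : Antitone μ := fun a b hab => Finset.card_le_card fun c hc => by
    simp only [Finset.mem_filter] at hc ⊢
    exact ⟨hc.1, by omega⟩
  have hfilter : ∀ i c, c < q → (i < l c ↔ c < μ i) := by
    intro i c hc
    constructor
    · intro h
      have : Finset.range (c + 1) ⊆ (Finset.range q).filter fun c => i < l c := fun x hx => by
        simp only [Finset.mem_filter, Finset.mem_range] at hx ⊢
        exact ⟨by omega, h.trans_le (hl (by omega))⟩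
      have := Finset.card_le_card this
      rw [Finset.card_range] at this
      exact this
    · intro h
      by_contra hlt
      suffices μ i ≤ c by omega
      have : ((Finset.range q).filter fun c => i < l c) ⊆ Finset.range c := fun x hx => by
        simp only [Finset.mem_filter, Finset.mem_range] at hx ⊢
        by_contra hxc
        have := hl (show c ≤ x by omega)
        omega
      exact (Finset.card_le_card this).trans (by simp)
  have hsum : ∑ i ∈ Finset.range q, μ i = ∑ c ∈ Finset.range q, l c :=
    sum_lt_card_filter l fun j _ => hle j
  have key := lowCount_add_rows_le hq D T μ hμ
    ((Finset.card_filter_le _ _).trans (by simp)) (by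
      simp only [hμdef, Finset.card_eq_zero, Finset.filter_eq_empty_iff]
      intro c _
      have := hle c
      omega)
  rw [hsum] at key
  refine key.trans (le_of_eq ?_)
  simp only [lowCount_add]
  rw [Finset.sum_add_distrib, ← lowCount_mul hq]
  congr 1
  have h1 : ∀ c ∈ Finset.range q,
      ∑ i ∈ Finset.range (l c), (if digitSum q (T + i) < D - c then 1 else 0) =
      ∑ i ∈ Finset.range q, if c < min (μ i) (D - digitSum q (T + i)) then 1 else 0 := by
    intro c hc
    rw [← sum_range_ite_lt (hle c)]
    refine Finset.sum_congr rfl fun i _ => ?_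
    have := hfilter i c (Finset.mem_range.1 hc)
    split_ifs <;> omega
  rw [Finset.sum_congr rfl h1, Finset.sum_comm]
  refine Finset.sum_congr rfl fun i _ => ?_
  rw [sum_range_boole_lt]
  have : μ i ≤ q := (Finset.card_filter_le _ _).trans (by simp)
  omega

/-! ### The numerical inequality behind the induction on dimension -/

/-- Initial segments of decreasing lengths, raised by `0, …, q - 1`, have at least as many elements
of low weight as one initial segment of the total length. -/
theorem lowCount_sum_le {q : ℕ} (hq : 1 < q) (D : ℕ) (K : ℕ → ℕ) (hK : Antitone K)
    (hKq : K q = 0) :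
    lowCount q D (∑ j ∈ Finset.range q, K j) ≤ ∑ j ∈ Finset.range q, lowCount q (D - j) (K j) := by
  induction hk : ∑ j ∈ Finset.range q, K j using Nat.strong_induction_on generalizing D K with
  | _ k ih =>
    subst hk
    -- Segments of length at most `q` are the rows of a Young diagram.
    rcases le_or_gt (K 0) q with h0 | h0
    · refine (lowCount_le_sum_rows hq D K hK h0 hKq).trans (Finset.sum_le_sum fun j _ => ?_)
      have h := lowCount_mul_add hq (D - j) 0 ((hK (Nat.zero_le j)).trans h0)
      simp only [mul_zero, zero_add, lowCount_zero_right, digitSum_zero, Nat.sub_zero] at h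
      exact h.ge
    have hdm : ∀ j, q * (K j / q) + K j % q = K j := fun j => Nat.div_add_mod _ _
    have hml : ∀ j, K j % q < q := fun j => Nat.mod_lt _ (by omega)
    -- `col c j` is the number of `m < K j` with last digit `c`.
    set col : ℕ → ℕ → ℕ := fun c j => K j / q + if c < K j % q then 1 else 0 with hcol
    have hanti : ∀ c, Antitone (col c) := by
      intro c a b hab
      have h := hK hab
      simp only [hcol]
      rcases (Nat.div_le_div_right h : K b / q ≤ K a / q).lt_or_eq with h1 | h1
      · split_ifs <;> omega
      · have ha := hdm a
        have hb := hdm b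
        rw [h1] at hb
        rw [h1]
        split_ifs <;> omega
    set T := ∑ j ∈ Finset.range q, K j / q with hT
    set l : ℕ → ℕ := fun c => ((Finset.range q).filter fun j => c < K j % q).card with hl
    have hcolsum : ∀ c, ∑ j ∈ Finset.range q, col c j = T + l c := by
      intro c
      simp only [hcol, hl, Finset.sum_add_distrib, Finset.card_filter, hT]
    have hlanti : Antitone l := fun a b hab => Finset.card_le_card fun c hc => by
      simp only [Finset.mem_filter] at hc ⊢
      exact ⟨hc.1, by omega⟩
    have hlsum : ∑ c ∈ Finset.range q, l c = ∑ j ∈ Finset.range q, K j % q :=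
      sum_lt_card_filter _ fun j _ => (hml j).le
    have htotal : q * T + ∑ c ∈ Finset.range q, l c = ∑ j ∈ Finset.range q, K j := by
      rw [hlsum, hT, Finset.mul_sum, ← Finset.sum_add_distrib]
      exact Finset.sum_congr rfl fun j _ => hdm j
    have hl0 : l 0 ≤ q := (Finset.card_filter_le _ _).trans (by simp)
    -- The induction descends because `q < K 0` forces `1 ≤ T`, so that `T < q * T`.
    have hlt : ∀ c, T + l c < ∑ j ∈ Finset.range q, K j := by
      intro c
      have h1 : l c ≤ l 0 := hlanti (Nat.zero_le c)
      have h2 : l 0 ≤ ∑ c ∈ Finset.range q, l c :=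
        Finset.single_le_sum (fun _ _ => Nat.zero_le _) (Finset.mem_range.2 (by omega))
      have h3 : 1 ≤ T := by
        have h4 : 1 ≤ K 0 / q := (Nat.one_le_div_iff (by omega)).2 h0.le
        exact h4.trans (Finset.single_le_sum (f := fun j => K j / q) (fun _ _ => Nat.zero_le _)
          (Finset.mem_range.2 (by omega)))
      have h5 : 2 * T ≤ q * T := Nat.mul_le_mul_right _ hq
      omega
    calc lowCount q D (∑ j ∈ Finset.range q, K j)
        = lowCount q D (q * T + ∑ c ∈ Finset.range q, l c) := by rw [htotal]
      _ ≤ ∑ c ∈ Finset.range q, lowCount q (D - c) (T + l c) :=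
          lowCount_le_sum_columns hq D T l hlanti hl0
      _ ≤ ∑ c ∈ Finset.range q, ∑ j ∈ Finset.range q, lowCount q (D - c - j) (col c j) := by
          refine Finset.sum_le_sum fun c _ => ?_
          rw [← hcolsum c]
          exact ih _ (by rw [hcolsum]; exact hlt c) (D - c) (col c) (hanti c)
            (by simp [hcol, hKq]) rfl
      _ = ∑ j ∈ Finset.range q, lowCount q (D - j) (K j) := by
          rw [Finset.sum_comm]
          refine Finset.sum_congr rfl fun j _ => ?_
          have h := lowCount_columns hq (D - j) (K j / q) (hml j).le
          rw [hdm] at h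
          rw [h]
          refine Finset.sum_congr rfl fun c _ => ?_
          rw [Nat.sub_right_comm]

/-! ### Slices and Hilbert functions -/

/-- The section of `S` at the value `a` of the first coordinate. -/
def headSlice {F : Type*} {n : ℕ} (S : Set (Fin (n + 1) → F)) (a : F) : Set (Fin n → F) :=
  {y | (Fin.cons a y : Fin (n + 1) → F) ∈ S}

theorem ncard_eq_sum_headSlice {F : Type*} [Fintype F] {n : ℕ} (S : Set (Fin (n + 1) → F)) :
    S.ncard = ∑ a : F, (headSlice S a).ncard := by
  let E : S ≃ Σ a : F, headSlice S a :=
    { toFun := fun x => ⟨x.1 0, Fin.tail x.1, by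
        show (Fin.cons (x.1 0) (Fin.tail x.1) : Fin (n + 1) → F) ∈ S
        rw [Fin.cons_self_tail]
        exact x.2⟩
      invFun := fun y => ⟨Fin.cons y.1 y.2.1, y.2.2⟩
      left_inv := fun x => Subtype.ext (Fin.cons_self_tail x.1)
      right_inv := fun y => rfl }
  rw [← Nat.card_coe_set_eq, Nat.card_congr E, Nat.card_sigma]
  simp only [Nat.card_coe_set_eq]

theorem exists_equiv_antitone {F : Type*} [Finite F] {q : ℕ} (hq : Nat.card F = q) (g : F → ℕ) :
    ∃ e : Fin q ≃ F, Antitone (g ∘ e) := by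
  let e₀ : Fin q ≃ F := (Finite.equivFinOfCardEq hq).symm
  let g' : Fin q → ℕᵒᵈ := fun j => OrderDual.toDual (g (e₀ j))
  exact ⟨(Tuple.sort g').trans e₀, fun i j hij => Tuple.monotone_sort g' hij⟩

section Hilbert

variable {F : Type*} [Field F] {n : ℕ}

theorem mem_restrictionSpace {S : Set (Fin n → F)} {d : ℕ} {φ : S → F} :
    φ ∈ restrictionSpace S d ↔ ∃ f : MvPolynomial (Fin n) F, f.totalDegree ≤ d ∧
      ∀ x : S, φ x = MvPolynomial.eval (x : Fin n → F) f := by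
  simp only [restrictionSpace, Submodule.mem_map, MvPolynomial.mem_restrictTotalDegree]
  refine exists_congr fun f => and_congr_right fun _ => ?_
  rw [funext_iff]
  refine forall_congr' fun x => ?_
  simp [MvPolynomial.aeval_eq_eval, eq_comm]

/-- The dimension of the space of restrictions to `S` of polynomials of degree less than `D`. -/
noncomputable def hilbertFunctionLT (S : Set (Fin n → F)) : ℕ → ℕ
  | 0 => 0
  | d + 1 => hilbertFunction S d

/-- Otherwise some multiple of `f`, subtracted from the product `P` of all `X i - e j` with `j < y
i`, gives a polynomial vanishing on the whole box below `y`. Its coefficient at the top-degree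
monomial with exponents `y i` is still `1`, against the combinatorial Nullstellensatz. -/
theorem eval_eq_zero_of_box {q : ℕ} (e : Fin q ≃ F) {f : MvPolynomial (Fin n) F}
    (y : Fin n → Fin q) (hf : f.totalDegree < ∑ i, (y i : ℕ))
    (h : ∀ z < y, MvPolynomial.eval (e ∘ z) f = 0) : MvPolynomial.eval (e ∘ y) f = 0 := by
  classical
  by_contra hy
  let P : MvPolynomial (Fin n) F :=
    ∏ i, ∏ j ∈ Finset.Iio (y i), (MvPolynomial.X i - MvPolynomial.C (e j))
  let t : Fin n →₀ ℕ := Finsupp.equivFunOnFinite.symm fun i => (y i : ℕ)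
  have ht : t.degree = ∑ i, (y i : ℕ) := by
    simp [t, Finsupp.degree_eq_sum]
  -- This order yields both the leading coefficient and the total degree of `P`.
  let m : MonomialOrder (Fin n) := MonomialOrder.degLex
  have hmon : ∀ i, m.Monic (∏ j ∈ Finset.Iio (y i), (MvPolynomial.X i - MvPolynomial.C (e j))) :=
    fun i => MonomialOrder.Monic.prod fun j _ => m.monic_X_sub_C i (e j)
  have hPmon : m.Monic P := MonomialOrder.Monic.prod fun i _ => hmon i
  have hPdeg : m.degree P = t := by
    rw [MonomialOrder.degree_prod fun i _ => (hmon i).ne_zero]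
    have : ∀ i, m.degree (∏ j ∈ Finset.Iio (y i),
        (MvPolynomial.X i - MvPolynomial.C (e j))) = Finsupp.single i (y i : ℕ) := by
      intro i
      rw [MonomialOrder.degree_prod fun j _ => (m.monic_X_sub_C i (e j)).ne_zero]
      simp [m.degree_X_sub_C]
    simp only [this]
    ext i
    simp [t, Finsupp.single_apply]
  have hPcoeff : P.coeff t = 1 := hPdeg ▸ hPmon
  have hPtot : P.totalDegree = t.degree := by
    rw [← MvPolynomial.degree_degLexDegree, ← hPdeg]
  have hPeval : ∀ z, z < y → MvPolynomial.eval (e ∘ z) P = 0 := by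
    intro z hz
    obtain ⟨hle, i, hi⟩ := Pi.lt_def.1 hz
    simp only [P, map_prod]
    refine Finset.prod_eq_zero (Finset.mem_univ i)
      (Finset.prod_eq_zero (Finset.mem_Iio.2 hi) (by simp))
  let c : F := MvPolynomial.eval (e ∘ y) P / MvPolynomial.eval (e ∘ y) f
  let g := P - MvPolynomial.C c * f
  have hgcoeff : g.coeff t = 1 := by
    have : f.coeff t = 0 := MvPolynomial.coeff_eq_zero_of_totalDegree_lt (by
      rw [← Finsupp.degree_apply, ht]; exact hf)
    simp [g, hPcoeff, this]
  have hgtot : g.totalDegree = t.degree := by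
    apply le_antisymm
    · refine (MvPolynomial.totalDegree_sub _ _).trans (max_le hPtot.le ?_)
      refine (MvPolynomial.totalDegree_mul _ _).trans ?_
      rw [MvPolynomial.totalDegree_C]
      omega
    · exact MvPolynomial.le_totalDegree (by simp [hgcoeff])
  obtain ⟨s, hs, hsg⟩ := MvPolynomial.combinatorial_nullstellensatz_exists_eval_nonzero g t
    (by simp [hgcoeff]) hgtot (fun i => (Finset.Iic (y i)).image e) (fun i => by
      rw [Finset.card_image_of_injective _ e.injective]
      simp [t])
  obtain ⟨z, rfl⟩ : ∃ z : Fin n → Fin q, s = e ∘ z := ⟨e.symm ∘ s, by ext; simp⟩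
  have hz : z ≤ y := fun i => by simpa using hs i
  apply hsg
  rcases hz.lt_or_eq with hz | rfl
  · simp [g, hPeval z hz, h z hz]
  · simp [g, c, hy]

/-- Restriction to the points of low weight is injective: vanishing spreads upwards through the
down-set by well-founded induction. -/
theorem hilbertFunction_image_le {q : ℕ} (e : Fin q ≃ F) {M : Set (Fin n → Fin q)}
    (hM : IsLowerSet M) (d : ℕ) :
    hilbertFunction ((e ∘ ·) '' M) d ≤ (lowWeight M d).ncard := by
  let pt : lowWeight M d → ((e ∘ ·) '' M : Set (Fin n → F)) := fun y =>
    ⟨e ∘ y.1, y.1, y.2.1, rfl⟩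
  let ev : restrictionSpace ((e ∘ ·) '' M) d →ₗ[F] (lowWeight M d → F) :=
    (LinearMap.funLeft F F pt).domRestrict _
  have hev : Function.Injective ev := by
    rw [injective_iff_map_eq_zero]
    rintro ⟨φ, hφ⟩ h0
    obtain ⟨f, hf, hφf⟩ := mem_restrictionSpace.1 hφ
    have hvan : ∀ y ∈ M, MvPolynomial.eval (e ∘ y) f = 0 := by
      intro y
      induction y using WellFoundedLT.induction with
      | _ y ih =>
        intro hy
        rcases le_or_gt (∑ i, (y i : ℕ)) d with hd | hd
        · have h1 : φ (pt ⟨y, hy, hd⟩) = 0 := congrFun h0 ⟨y, hy, hd⟩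
          rw [hφf] at h1
          exact h1
        · exact eval_eq_zero_of_box e y (by omega) fun z hz => ih z hz (hM hz.le hy)
    refine Subtype.ext (funext fun x => ?_)
    obtain ⟨y, hy, hyx⟩ := x.2
    refine (hφf x).trans ?_
    rw [← hyx]
    exact hvan y hy
  have := Fintype.ofFinite (lowWeight M d)
  have h := LinearMap.finrank_le_finrank_of_injective hev
  rwa [Module.finrank_pi, ← Nat.card_eq_fintype_card, Nat.card_coe_set_eq] at h

variable [Finite F]

theorem one_le_hilbertFunction {S : Set (Fin n → F)} (hS : S.Nonempty) (d : ℕ) :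
    1 ≤ hilbertFunction S d := by
  obtain ⟨x, hx⟩ := hS
  have h : (fun _ => 1 : S → F) ∈ restrictionSpace S d :=
    mem_restrictionSpace.2 ⟨1, by simp, by simp⟩
  have : Nontrivial (restrictionSpace S d) :=
    ⟨⟨_, h⟩, 0, fun h0 => one_ne_zero (congrFun (congrArg Subtype.val h0) ⟨x, hx⟩)⟩
  exact Module.finrank_pos

/-- A polynomial on the slice extends to one of no larger degree that does not involve `X 0`. The
bound concerns the image of restriction, as rank–nullity requires. -/
theorem finrank_headSlice_le (S : Set (Fin (n + 1) → F)) (a : F) (d : ℕ) :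
    hilbertFunction (headSlice S a) d ≤ Module.finrank F ((restrictionSpace S d).map
      (LinearMap.funLeft F F fun y : headSlice S a => (⟨Fin.cons a y.1, y.2⟩ : S))) := by
  refine Submodule.finrank_mono fun φ hφ => ?_
  obtain ⟨f, hf, hφf⟩ := mem_restrictionSpace.1 hφ
  refine Submodule.mem_map.2 ⟨fun x => MvPolynomial.eval x.1 (MvPolynomial.rename Fin.succ f),
    mem_restrictionSpace.2 ⟨_, (MvPolynomial.totalDegree_rename_le _ _).trans hf, fun _ => rfl⟩, ?_⟩
  ext y
  rw [LinearMap.funLeft_apply, hφf, MvPolynomial.eval_rename]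
  rfl

theorem hilbertFunction_headSlice_le (S : Set (Fin (n + 1) → F)) (a : F) (d : ℕ) :
    hilbertFunction (headSlice S a) d ≤ hilbertFunction S d :=
  (finrank_headSlice_le S a d).trans (Submodule.finrank_map_le _ _)

/-- Rank–nullity for restriction to the slice: the kernel contains the multiples of `X 0 - a`, and
off the slice division by `x 0 - a` recovers the cofactor. -/
theorem hilbertFunction_headSlice_add_le (S : Set (Fin (n + 1) → F)) (a : F) (d : ℕ) :
    hilbertFunction (headSlice S a) (d + 1) + hilbertFunction {x ∈ S | x 0 ≠ a} d ≤
      hilbertFunction S (d + 1) := by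
  set R := LinearMap.funLeft F F fun y : headSlice S a => (⟨Fin.cons a y.1, y.2⟩ : S) with hR
  set V := restrictionSpace S (d + 1) with hV
  have h1 := LinearMap.finrank_range_add_finrank_ker (R.domRestrict V)
  rw [LinearMap.range_domRestrict] at h1
  have h2 : hilbertFunction {x ∈ S | x 0 ≠ a} d ≤
      Module.finrank F (LinearMap.ker (R.domRestrict V)) := by
    let N : (S → F) →ₗ[F] ({x ∈ S | x 0 ≠ a} : Set _) → F :=
      LinearMap.pi fun x => (x.1 0 - a)⁻¹ • LinearMap.proj (⟨x.1, x.2.1⟩ : S)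
    have h3 : restrictionSpace {x ∈ S | x 0 ≠ a} d ≤
        (LinearMap.ker (R.domRestrict V)).map (N.comp V.subtype) := by
      intro φ hφ
      obtain ⟨f, hf, hφf⟩ := mem_restrictionSpace.1 hφ
      have hdeg : ((MvPolynomial.X 0 - MvPolynomial.C a) * f).totalDegree ≤ d + 1 := by
        refine (MvPolynomial.totalDegree_mul _ _).trans ?_
        have : (MvPolynomial.X (0 : Fin (n + 1)) - MvPolynomial.C a :
            MvPolynomial (Fin (n + 1)) F).totalDegree ≤ 1 :=
          (MvPolynomial.totalDegree_sub_C_le _ _).trans (MvPolynomial.totalDegree_X _).le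
        omega
      refine Submodule.mem_map.2 ⟨⟨fun x => MvPolynomial.eval x.1
        ((MvPolynomial.X 0 - MvPolynomial.C a) * f),
        mem_restrictionSpace.2 ⟨_, hdeg, fun _ => rfl⟩⟩, ?_, ?_⟩
      · rw [LinearMap.mem_ker]
        ext y
        simp [hR, LinearMap.funLeft_apply]
      · ext x
        have hx : x.1 0 - a ≠ 0 := sub_ne_zero.2 x.2.2
        simp [N, hφf, hx]
    exact (Submodule.finrank_mono h3).trans (Submodule.finrank_map_le _ _)
  have h4 : _ ≤ Module.finrank F (V.map R) := finrank_headSlice_le S a (d + 1)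
  exact (add_le_add h4 h2).trans h1.le

theorem hilbertFunctionLT_headSlice_add_le (S : Set (Fin (n + 1) → F)) (a : F) (D : ℕ) :
    hilbertFunctionLT (headSlice S a) D + hilbertFunctionLT {x ∈ S | x 0 ≠ a} (D - 1) ≤
      hilbertFunctionLT S D := by
  match D with
  | 0 => simp [hilbertFunctionLT]
  | 1 => simpa [hilbertFunctionLT] using hilbertFunction_headSlice_le S a 0
  | d + 2 => exact hilbertFunction_headSlice_add_le S a d

/-- Slices are peeled off one at a time; the remaining ones are unchanged and the bound drops by
one. -/
theorem sum_hilbertFunctionLT_headSlice_le (p : ℕ) (a : ℕ → F)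
    (ha : Set.InjOn a (Set.Iio p)) (S : Set (Fin (n + 1) → F)) (D : ℕ) :
    ∑ j ∈ Finset.range p, hilbertFunctionLT (headSlice S (a j)) (D - j) ≤
      hilbertFunctionLT S D := by
  induction p generalizing a S D with
  | zero => simp
  | succ p ih =>
    rw [Finset.sum_range_succ', Nat.sub_zero]
    have h := ih (fun j => a (j + 1)) (fun i hi j hj hij => by
      have hi : i < p := hi
      have hj : j < p := hj
      have := ha (show i + 1 < p + 1 by omega) (show j + 1 < p + 1 by omega) hij
      omega) {x ∈ S | x 0 ≠ a 0} (D - 1)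
    have h2 : ∀ j ∈ Finset.range p,
        hilbertFunctionLT (headSlice {x ∈ S | x 0 ≠ a 0} (a (j + 1))) (D - 1 - j) =
        hilbertFunctionLT (headSlice S (a (j + 1))) (D - (j + 1)) := by
      intro j hj
      have hj := Finset.mem_range.1 hj
      have hne : a (j + 1) ≠ a 0 := fun h => by
        have := ha (show j + 1 < p + 1 by omega) (show 0 < p + 1 by omega) h
        omega
      congr 1
      · ext y
        simp [headSlice, hne]
      · omega
    rw [Finset.sum_congr rfl h2] at h
    have := hilbertFunctionLT_headSlice_add_le S (a 0) D
    omega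

theorem lowCount_le_hilbertFunctionLT {q : ℕ} (hq : Nat.card F = q) (S : Set (Fin n → F)) (D : ℕ) :
    lowCount q D S.ncard ≤ hilbertFunctionLT S D := by
  have hq1 : 1 < q := hq ▸ Finite.one_lt_card
  induction n generalizing D with
  | zero =>
    rcases S.eq_empty_or_nonempty with rfl | hS
    · simp [lowCount_zero_right]
    · have h1 : S.ncard = 1 := by
        obtain ⟨x, hx⟩ := hS
        rw [Set.ncard_eq_one]
        exact ⟨x, Set.eq_singleton_iff_unique_mem.2 ⟨hx, fun y _ => Subsingleton.elim _ _⟩⟩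
      rw [h1, lowCount_one]
      match D with
      | 0 => simp
      | d + 1 => exact (min_le_left _ _).trans (one_le_hilbertFunction hS d)
  | succ n ih =>
    have := Fintype.ofFinite F
    -- The largest slices get the largest degree bounds; padding by zeros gives `K q = 0`.
    obtain ⟨e, he⟩ := exists_equiv_antitone hq fun a => (headSlice S a).ncard
    let K : ℕ → ℕ := fun j => if h : j < q then (headSlice S (e ⟨j, h⟩)).ncard else 0
    let a : ℕ → F := fun j => if h : j < q then e ⟨j, h⟩ else 0
    have hK : Antitone K := by
      intro i j hij
      by_cases hj : j < q
      · have hi : i < q := by omega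
        simp only [K, dif_pos hi, dif_pos hj]
        exact he (show (⟨i, hi⟩ : Fin q) ≤ ⟨j, hj⟩ from hij)
      · simp [K, hj]
    have hsum : ∑ j ∈ Finset.range q, K j = S.ncard := by
      rw [ncard_eq_sum_headSlice, ← e.sum_comp, Finset.sum_range]
      exact Finset.sum_congr rfl fun j _ => by simp [K]
    rw [← hsum]
    refine (lowCount_sum_le hq1 D K hK (by simp [K])).trans (le_trans ?_
      (sum_hilbertFunctionLT_headSlice_le q a (fun i hi j hj hij => ?_) S D))
    · refine Finset.sum_le_sum fun j hj => ?_
      have hj := Finset.mem_range.1 hj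
      simp only [K, a, dif_pos hj]
      exact ih _ _
    · have hi : i < q := hi
      have hj : j < q := hj
      simp only [a, dif_pos hi, dif_pos hj] at hij
      simpa using e.injective hij

end Hilbert

/-! ### Lexicographic ranks -/

/-- The position of `x` in the lexicographic order of `{0, …, q - 1} ^ n`. -/
def lexRank (q : ℕ) : (n : ℕ) → (Fin n → Fin q) → ℕ
  | 0, _ => 0
  | n + 1, x => q ^ n * x 0 + lexRank q n (Fin.tail x)

theorem lexRank_lt {q n : ℕ} (x : Fin n → Fin q) : lexRank q n x < q ^ n := by
  induction n with
  | zero => simp [lexRank]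
  | succ n ih =>
    have h1 := ih (Fin.tail x)
    have h2 : q ^ n * (x 0 + 1) ≤ q ^ n * q := Nat.mul_le_mul_left _ (x 0).2
    rw [lexRank, pow_succ]
    rw [mul_add] at h2
    omega

theorem lexRank_lt_lexRank {q n : ℕ} {x y : Fin n → Fin q} (h : toLex x < toLex y) :
    lexRank q n x < lexRank q n y := by
  induction n with
  | zero => exact absurd (Subsingleton.elim (toLex x) (toLex y)) h.ne
  | succ n ih =>
    have h1 : Pi.Lex (· < ·) (· < ·) (Fin.cons (x 0) (Fin.tail x) : Fin (n + 1) → Fin q)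
        (Fin.cons (y 0) (Fin.tail y)) := by
      rw [Fin.cons_self_tail, Fin.cons_self_tail]
      exact h
    rw [Fin.pi_lex_lt_cons_cons] at h1
    rw [lexRank, lexRank]
    rcases h1 with h1 | ⟨h1, h2⟩
    · have h3 : q ^ n * (x 0 + 1) ≤ q ^ n * y 0 := Nat.mul_le_mul_left _ h1
      have := lexRank_lt (Fin.tail x)
      rw [mul_add] at h3
      omega
    · rw [h1]
      exact Nat.add_lt_add_left (ih h2) _

theorem lexRank_strictMono (q n : ℕ) :
    StrictMono fun x : Lex (Fin n → Fin q) => lexRank q n (ofLex x) :=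
  fun _ _ h => lexRank_lt_lexRank h

theorem lexRank_injective (q n : ℕ) : Function.Injective (lexRank q n) :=
  fun _ _ h => toLex.injective ((lexRank_strictMono q n).injective h)

theorem exists_lexRank_eq {q n m : ℕ} (hm : m < q ^ n) : ∃ x, lexRank q n x = m := by
  have h : Function.Bijective
      fun x : Fin n → Fin q => (⟨lexRank q n x, lexRank_lt x⟩ : Fin (q ^ n)) :=
    (Fintype.bijective_iff_injective_and_card _).2
      ⟨fun _ _ h => lexRank_injective q n (Fin.mk.inj_iff.1 h), by simp⟩
  obtain ⟨x, hx⟩ := h.2 ⟨m, hm⟩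
  exact ⟨x, Fin.mk.inj_iff.1 hx⟩

theorem digitSum_lexRank {q : ℕ} (hq : 1 < q) {n : ℕ} (x : Fin n → Fin q) :
    digitSum q (lexRank q n x) = ∑ i, (x i : ℕ) := by
  induction n with
  | zero => simp [lexRank, digitSum_zero]
  | succ n ih =>
    rw [lexRank, digitSum_mul_pow_add hq n _ (lexRank_lt _), ih, Fin.sum_univ_succ,
      digitSum_of_lt hq (x 0).2]
    rfl

theorem ncard_preimage_lexRank {q n : ℕ} {T : Set ℕ} (hT : ∀ m ∈ T, m < q ^ n) :
    (lexRank q n ⁻¹' T).ncard = T.ncard := by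
  rw [← Set.ncard_image_of_injective _ (lexRank_injective q n), Set.image_preimage_eq_of_subset]
  exact fun m hm => exists_lexRank_eq (hT m hm)

theorem lexFirst_eq (n q k : ℕ) : lexFirst n q k = lexRank q n ⁻¹' Set.Iio k := by
  ext x
  have h : {y : Fin n → Fin q | toLex y < toLex x} =
      lexRank q n ⁻¹' Set.Iio (lexRank q n x) := by
    ext y
    exact (lexRank_strictMono q n).lt_iff_lt.symm
  have h2 : (lexRank q n ⁻¹' Set.Iio (lexRank q n x)).ncard = (Set.Iio (lexRank q n x)).ncard :=
    ncard_preimage_lexRank fun m hm => lt_trans (Set.mem_Iio.1 hm) (lexRank_lt x)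
  change {y : Fin n → Fin q | toLex y < toLex x}.ncard < k ↔ _
  rw [h, h2, ← Finset.coe_Iio, Set.ncard_coe_finset, Nat.card_Iio]
  rfl

/-- The lexicographic order extends the product order. -/
theorem isLowerSet_lexFirst (n q k : ℕ) : IsLowerSet (lexFirst n q k) := by
  intro x y hxy hx
  rw [lexFirst_eq] at hx ⊢
  exact lt_of_le_of_lt ((lexRank_strictMono q n).monotone (Pi.toLex_monotone hxy)) hx

theorem ncard_lexFirst {n q k : ℕ} (hk : k ≤ q ^ n) : (lexFirst n q k).ncard = k := by
  have h : (lexRank q n ⁻¹' Set.Iio k).ncard = (Set.Iio k).ncard :=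
    ncard_preimage_lexRank fun m hm => lt_of_lt_of_le (Set.mem_Iio.1 hm) hk
  rw [lexFirst_eq, h, ← Finset.coe_Iio, Set.ncard_coe_finset, Nat.card_Iio]

theorem ncard_lowWeight_lexFirst {n q k : ℕ} (hq : 1 < q) (hk : k ≤ q ^ n) (d : ℕ) :
    (lowWeight (lexFirst n q k) d).ncard = lowCount q (d + 1) k := by
  have h : lowWeight (lexFirst n q k) d = lexRank q n ⁻¹'
      ((Finset.range k).filter fun m => digitSum q m < d + 1 : Finset ℕ) := by
    ext x
    rw [lowWeight, lexFirst_eq]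
    simp [digitSum_lexRank hq]
  rw [h, ncard_preimage_lexRank, Set.ncard_coe_finset, lowCount]
  intro m hm
  simp only [Finset.coe_filter, Finset.mem_range, Set.mem_ofPred_eq] at hm
  omega

/-! ### The binary case and the conclusion -/

/-- For `q = 2`, splitting by the last digit is Pascal's rule. -/
theorem lowCount_two_pow (m d : ℕ) : lowCount 2 (d + 1) (2 ^ m) = chooseLE m d := by
  induction m generalizing d with
  | zero =>
    rw [pow_zero, lowCount_one, chooseLE, Finset.sum_range_succ']
    simp
  | succ m ih =>
    have h : chooseLE (m + 1) d =
        ∑ i ∈ Finset.range d, m.choose i + ∑ i ∈ Finset.range d, m.choose (i + 1) + 1 := by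
      rw [chooseLE, Finset.sum_range_succ']
      simp only [Nat.choose_succ_succ', Finset.sum_add_distrib, Nat.choose_zero_right]
    rw [pow_succ', lowCount_mul one_lt_two, show Finset.range 2 = Finset.range (1 + 1) from rfl,
      Finset.sum_range_succ, Finset.sum_range_one, Nat.sub_zero, ih, Nat.add_sub_cancel, h,
      chooseLE, Finset.sum_range_succ', Nat.choose_zero_right]
    match d with
    | 0 => simp [lowCount_zero_left]
    | d + 1 =>
      rw [ih, chooseLE]
      omega

theorem mainTheorem3 :
    (∀ q : ℕ, IsPrimePow q → ∀ (F : Type*) [Field F], Nat.card F = q →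
      ∀ n k d : ℕ, k ≤ q ^ n →
        IsLeast {h : ℕ | ∃ S : Set (Fin n → F), S.ncard = k ∧ hilbertFunction S d = h}
          (lowWeight (lexFirst n q k) d).ncard) ∧
    (∀ (F : Type*) [Field F], Nat.card F = 2 →
      ∀ n k d : ℕ, 1 ≤ k → k ≤ 2 ^ n →
        ∀ S : Set (Fin n → F), S.ncard = k →
          chooseLE ⌊Real.logb 2 (k : ℝ)⌋₊ d ≤ hilbertFunction S d) := by
  constructor
  · intro q hq F _ hF n k d hk
    have : Finite F := Nat.finite_of_card_ne_zero (hF ▸ hq.pos.ne')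
    have hlow : ∀ S : Set (Fin n → F), S.ncard = k →
        (lowWeight (lexFirst n q k) d).ncard ≤ hilbertFunction S d := by
      rintro S rfl
      rw [ncard_lowWeight_lexFirst hq.one_lt hk]
      exact lowCount_le_hilbertFunctionLT hF S (d + 1)
    refine ⟨?_, ?_⟩
    -- Any bijection works: the upper bound uses only the order of the labels.
    · let e : Fin q ≃ F := (Finite.equivFinOfCardEq hF).symm
      have hcard : ((e ∘ ·) '' lexFirst n q k : Set (Fin n → F)).ncard = k := by
        rw [Set.ncard_image_of_injective _ e.injective.comp_left, ncard_lexFirst hk]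
      exact ⟨_, hcard, le_antisymm (hilbertFunction_image_le e (isLowerSet_lexFirst n q k) d)
        (hlow _ hcard)⟩
    · rintro _ ⟨S, hS, rfl⟩
      exact hlow S hS
  · intro F _ hF n k d hk _ S hS
    have : Finite F := Nat.finite_of_card_ne_zero (by omega)
    have hlog : ⌊Real.logb 2 (k : ℝ)⌋₊ = Nat.log 2 k := by
      exact_mod_cast Real.natFloor_logb_natCast 2 k
    rw [hlog, ← lowCount_two_pow]
    refine (lowCount_mono_right 2 (d + 1) (Nat.pow_log_le_self 2 (by omega))).trans ?_
    rw [← hS]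
    exact lowCount_le_hilbertFunctionLT hF S (d + 1)
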